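/- Let $n\ge 2$. All manifolds are $n$-dimensional, oriented, Hausdorff, second countable and of class $C^1$, with continuous Riemannian metrics; charts are positively oriented $C^1$ charts. For a map $\phi:M\to N$, a localization of $\phi$ is a restriction $\phi:U\to V$, where $U\subset M$ and $V\subset N$ are domains of charts $\psi$ and $\chi$ and $\overline{\phi(U)}$ is compact and contained in $V$; it is a localization at $p$ if $p\in U$, and its coordinate representation is $\chi\circ\phi\circ\psi^{-1}:\psi(U)\to\mathbb{R}^n$. The map $\phi$ is localizable if every $p\in M$ has a neighbourhood $U$ such that $\overline{\phi(U)}$ is compact and contained in some chart domain $V$. A localizable map $\phi:(M,g)\to(N,h)$ is Riemannian $K$-quasiregular ($K\ge 1$) if the coordinate representation of every localization belongs to $W^{1,n}_{loc}$ and has weak Jacobian determinant that is either a.e. non-negative or a.e. non-positive, and $$\Big(\tfrac1n\operatorname{tr}(g^{-1}\phi^*h)\Big)^n\le K^2\det(g^{-1}\phi^*h)\quad\text{a.e.},$$ where, in the coordinates of a localization, $\phi^*h=D\phi^T\,(h\circ\phi)\,D\phi$ with the weak differential $D\phi$. A map $f:\Omega\to\mathbb{R}^n$, $\Omega\subset\mathbb{R}^n$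 open, is $\overline K$-quasiregular in the classical sense ($\overline K\ge1$) if $f\in W^{1,n}_{loc}(\Omega,\mathbb{R}^n)$, its weak Jacobian determinant $J_f$ is either a.e. non-negative or a.e. non-positive on $\Omega$, and $\|Df\|_{op}^n\le\overline K\,|J_f|$ a.e. on $\Omega$. **Theorem.** There is a function $C$, with values in $[0,\infty]$, of a number $K$ and of two coordinate expressions of metrics (a set in $\mathbb{R}^n$ and a matrix-valued function on it), depending on nothing else but $n$, such that the following holds for every Riemannian $K$-quasiregular map $\phi:(M,g)\to(N,h)$. For a localization $\phi:U\to V$ with charts $\psi,\chi$ write $\overline K=C(K,g_\psi,h_\chi)$, where $g_\psi$ and $h_\chi$ are the coordinate expressions of $g$ on $U$ and of $h$ on $V$. 1. For every $p\in M$ there is a localization $\phi:U\to V$ at $p$ such that $\overline K<\infty$ and the coordinate representation $\chi\circ\phi\circ\psi^{-1}$ is $\overline K$-quasiregular on $\psi(U)$ in the classical sense. 2. More generally, every localization with $\overline K<\infty$ has a $\overline K$-quasiregular coordinate representation. -/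

import Mathlib

open Set Filter Topology MeasureTheory
open scoped Manifold ContDiff ENNReal Matrix

noncomputable section

/-! ### Sobolev maps and quasiregular maps on open subsets of Euclidean space -/

/-- `ℝⁿ` with its Euclidean norm. -/
abbrev Euc (n : ℕ) : Type := EuclideanSpace ℝ (Fin n)

/-- `D` is the weak differential of `f` on the open set `Ω`: both are locally integrable on `Ω` and
`∫ (∂ᵥη) f = - ∫ η (D v)` for all directions `v` and all smooth test functions `η` with compact
support in `Ω`. -/
structure IsWeakDifferential {n : ℕ} (Ω : Set (Euc n)) (f : Euc n → Euc n)
    (D : Euc n → Euc n →L[ℝ] Euc n) : Prop where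
  locallyIntegrable : LocallyIntegrableOn f Ω
  locallyIntegrable_differential : LocallyIntegrableOn D Ω
  integral_eq : ∀ η : Euc n → ℝ, ContDiff ℝ ∞ η → HasCompactSupport η → tsupport η ⊆ Ω →
    ∀ v : Euc n, ∫ x in Ω, (fderiv ℝ η x v) • f x = - ∫ x in Ω, η x • D x v

/-- `f ∈ L^p_loc(Ω)`. -/
def MemLpLoc {n : ℕ} {F : Type} [NormedAddCommGroup F] (p : ℝ≥0∞) (Ω : Set (Euc n))
    (f : Euc n → F) : Prop :=
  ∀ k : Set (Euc n), IsCompact k → k ⊆ Ω → MemLp f p (volume.restrict k)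

/-- `f ∈ W^{1,n}_loc(Ω, ℝⁿ)`, where `n` is the dimension. -/
def MemSobolevLoc {n : ℕ} (Ω : Set (Euc n)) (f : Euc n → Euc n) : Prop :=
  MemLpLoc n Ω f ∧ ∃ D, IsWeakDifferential Ω f D ∧ MemLpLoc n Ω D

/-- The (weak) Jacobian determinant of `f` is non-negative a.e. on `Ω` or non-positive a.e. on
`Ω`. -/
def HasConstantSignJacobian {n : ℕ} (Ω : Set (Euc n)) (f : Euc n → Euc n) : Prop :=
  ∀ D, IsWeakDifferential Ω f D →
    (∀ᵐ x ∂volume.restrict Ω, 0 ≤ (D x).det) ∨ (∀ᵐ x ∂volume.restrict Ω, (D x).det ≤ 0)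

/-- `f : Ω → ℝⁿ` is `K`-quasiregular in the classical sense. -/
structure IsClassicallyQuasiregular {n : ℕ} (K : ℝ) (Ω : Set (Euc n)) (f : Euc n → Euc n) : Prop where
  isOpen : IsOpen Ω
  one_le : 1 ≤ K
  sobolev : MemSobolevLoc Ω f
  sign : HasConstantSignJacobian Ω f
  distortion : ∀ D, IsWeakDifferential Ω f D →
    ∀ᵐ x ∂volume.restrict Ω, ‖D x‖ ^ n ≤ K * |(D x).det|

/-! ### Normalized trace and determinant -/

/-- The Jacobian matrix: the matrix of a linear map in the standard basis of `ℝⁿ`. -/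
def jacobianMatrix {n : ℕ} (L : Euc n →L[ℝ] Euc n) : Matrix (Fin n) (Fin n) ℝ :=
  LinearMap.toMatrix (EuclideanSpace.basisFun (Fin n) ℝ).toBasis
    (EuclideanSpace.basisFun (Fin n) ℝ).toBasis L.toLinearMap

/-- The invariant normalized trace `Tr_g(T) = (1/n) tr(g⁻¹ T)`. -/
def normTrace {n : ℕ} (g T : Matrix (Fin n) (Fin n) ℝ) : ℝ := (1 / (n : ℝ)) * (g⁻¹ * T).trace

/-- The invariant determinant `Det_g(T) = det(g⁻¹ T)`. -/
def invDet {n : ℕ} (g T : Matrix (Fin n) (Fin n) ℝ) : ℝ := (g⁻¹ * T).det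

/-! ### Oriented Riemannian manifolds of class `C¹` -/

section Manifolds

variable {n : ℕ}

/-- An orientation of a `C¹` manifold, given as its maximal oriented atlas: a maximal family of
`C¹` charts covering the manifold whose transition maps have positive Jacobian determinant. -/
structure OrientedAtlas (n : ℕ) (M : Type*) [TopologicalSpace M] [ChartedSpace (Euc n) M] where
  charts : Set (OpenPartialHomeomorph M (Euc n))
  subset_maximalAtlas : charts ⊆ IsManifold.maximalAtlas 𝓘(ℝ, Euc n) 1 M
  cover : ∀ p : M, ∃ ψ ∈ charts, p ∈ ψ.source
  compatible : ∀ ψ ∈ charts, ∀ ψ' ∈ charts, ∀ p ∈ ψ.source ∩ ψ'.source,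
    0 < (fderiv ℝ (ψ' ∘ ψ.symm) (ψ p)).det
  maximal : ∀ ψ ∈ IsManifold.maximalAtlas 𝓘(ℝ, Euc n) 1 M,
    (∀ ψ' ∈ charts, ∀ p ∈ ψ.source ∩ ψ'.source, 0 < (fderiv ℝ (ψ' ∘ ψ.symm) (ψ p)).det) →
      ψ ∈ charts

/-- Continuous Riemannian metrics on a `C¹` manifold. -/
abbrev ContMetric (n : ℕ) (M : Type*) [TopologicalSpace M] [ChartedSpace (Euc n) M]
    [IsManifold 𝓘(ℝ, Euc n) 1 M] :=
  Bundle.ContinuousRiemannianMetric (Euc n) (fun p : M => TangentSpace 𝓘(ℝ, Euc n) p)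

/-- The coordinate representation of `g` in the chart `ψ`: the matrix `g(∂ᵢ, ∂ⱼ)` at the point
with coordinates `x` (meaningful for `x ∈ ψ.target`). -/
def metricMatrix {M : Type*} [TopologicalSpace M] [ChartedSpace (Euc n) M]
    [IsManifold 𝓘(ℝ, Euc n) 1 M] (g : ContMetric n M) (ψ : OpenPartialHomeomorph M (Euc n))
    (x : Euc n) : Matrix (Fin n) (Fin n) ℝ :=
  Matrix.of fun i j => g.inner (ψ.symm x)
    (mfderiv 𝓘(ℝ, Euc n) 𝓘(ℝ, Euc n) ψ.symm x (EuclideanSpace.basisFun (Fin n) ℝ i))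
    (mfderiv 𝓘(ℝ, Euc n) 𝓘(ℝ, Euc n) ψ.symm x (EuclideanSpace.basisFun (Fin n) ℝ j))

/-- A coordinate domain in `ℝⁿ` together with a matrix-valued function on it: the data of a
coordinate representation of a Riemannian metric. -/
structure CoordMetric (n : ℕ) where
  domain : Set (Euc n)
  matrix : domain → Matrix (Fin n) (Fin n) ℝ

/-- The coordinate representation of `g` on the domain of the chart `ψ`. -/
def coordMetric {M : Type*} [TopologicalSpace M] [ChartedSpace (Euc n) M]
    [IsManifold 𝓘(ℝ, Euc n) 1 M] (g : ContMetric n M) (ψ : OpenPartialHomeomorph M (Euc n)) :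
    CoordMetric n where
  domain := ψ.target
  matrix := fun x => metricMatrix g ψ x

variable {M N : Type*} [TopologicalSpace M] [ChartedSpace (Euc n) M]
  [TopologicalSpace N] [ChartedSpace (Euc n) N]

/-- `A ⊂⊂ V`: the closure of `A` is compact and contained in `V`. -/
def CompactlyContained {X : Type*} [TopologicalSpace X] (A V : Set X) : Prop :=
  IsCompact (closure A) ∧ closure A ⊆ V

/-- Every point has a neighbourhood mapped compactly into the domain of a chart. -/
def IsLocalizable (oN : OrientedAtlas n N) (φ : M → N) : Prop :=
  ∀ p : M, ∃ U ∈ 𝓝 p, ∃ χ ∈ oN.charts, CompactlyContained (φ '' U) χ.source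

/-- The restriction `φ : U → V` is a localization of `φ`, where `U` and `V` are the domains of the
charts `ψ` and `χ`. It is a localization at each point of `U`. -/
structure IsLocalizationOf (oM : OrientedAtlas n M) (oN : OrientedAtlas n N) (φ : M → N)
    (ψ : OpenPartialHomeomorph M (Euc n)) (χ : OpenPartialHomeomorph N (Euc n)) : Prop where
  mem_left : ψ ∈ oM.charts
  mem_right : χ ∈ oN.charts
  compactlyContained : CompactlyContained (φ '' ψ.source) χ.source

/-- The coordinate representation `χ ∘ φ ∘ ψ⁻¹` of a localization, considered on `ψ.target`. -/
def coordRep (φ : M → N) (ψ : OpenPartialHomeomorph M (Euc n))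
    (χ : OpenPartialHomeomorph N (Euc n)) : Euc n → Euc n :=
  χ ∘ φ ∘ ψ.symm

/-- `φ ∈ W^{1,n}_loc(M, N)`: all coordinate representations of localizations are in
`W^{1,n}_loc`. -/
def MemSobolevLocManifold (oM : OrientedAtlas n M) (oN : OrientedAtlas n N) (φ : M → N) : Prop :=
  ∀ ψ χ, IsLocalizationOf oM oN φ ψ χ → MemSobolevLoc ψ.target (coordRep φ ψ χ)

/-- The Jacobian determinant of `φ` has locally constant sign. -/
def HasLocallyConstantSign (oM : OrientedAtlas n M) (oN : OrientedAtlas n N) (φ : M → N) : Prop :=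
  ∀ ψ χ, IsLocalizationOf oM oN φ ψ χ → HasConstantSignJacobian ψ.target (coordRep φ ψ χ)

variable [IsManifold 𝓘(ℝ, Euc n) 1 M] [IsManifold 𝓘(ℝ, Euc n) 1 N]

/-- The coordinate matrix `Dφᵀ (h ∘ φ) Dφ` at `x` of the pullback `φ^* h`, where `D` is the weak
differential of the coordinate representation of `φ`. -/
def pullbackMatrix (h : ContMetric n N) (φ : M → N) (ψ : OpenPartialHomeomorph M (Euc n))
    (χ : OpenPartialHomeomorph N (Euc n)) (D : Euc n → Euc n →L[ℝ] Euc n) (x : Euc n) :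
    Matrix (Fin n) (Fin n) ℝ :=
  (jacobianMatrix (D x))ᵀ * metricMatrix h χ (coordRep φ ψ χ x) * jacobianMatrix (D x)

/-- `φ : (M, g) → (N, h)` is Riemannian `K`-quasiregular. The sets of measure zero of the
Riemannian volume are those which are Lebesgue null in all charts. -/
structure IsRiemannianQuasiregular (oM : OrientedAtlas n M) (oN : OrientedAtlas n N)
    (g : ContMetric n M) (h : ContMetric n N) (K : ℝ) (φ : M → N) : Prop where
  one_le : 1 ≤ K
  localizable : IsLocalizable oN φ
  sobolev : MemSobolevLocManifold oM oN φ
  sign : HasLocallyConstantSign oM oN φ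
  distortion : ∀ ψ χ, IsLocalizationOf oM oN φ ψ χ →
    ∀ D, IsWeakDifferential ψ.target (coordRep φ ψ χ) D →
      ∀ᵐ x ∂volume.restrict ψ.target,
        normTrace (metricMatrix g ψ x) (pullbackMatrix h φ ψ χ D x) ^ n ≤
          K ^ 2 * invDet (metricMatrix g ψ x) (pullbackMatrix h φ ψ χ D x)

end Manifolds

end

/-! ### Linear algebra: normalized trace, determinant and ellipticity bounds -/

section LinearAlgebra

variable {n : ℕ}

/-! The Sobolev and sign conditions are the same in both notions, so only the distortion inequality
needs proof, and it is pointwise linear algebra. Let `G` have eigenvalues in `[l, m]`, `H` in `[l',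
m']`, and let `J` be the matrix of `L`. Then `tr(G⁻¹JᵀHJ) ≥ (l'/m) ‖L‖²` and `det(G⁻¹JᵀHJ) ≤ (m'/l)ⁿ
(det L)²`, so the Riemannian inequality gives `‖L‖²ⁿ ≤ (n (m/l) (m'/l'))ⁿ K² (det L)²`. Only the
eigenvalue ratios enter; they are bounded by the eccentricities, whence the constant `K (n · ecc g ·
ecc h)^(n/2)`. This is `norm_pow_le_of_distortion`.

The constant is finite once both eccentricities are. In a chart a continuous metric has locally
bounded eccentricity, so it suffices to shrink both charts to relatively compact pieces of larger
ones: `eccentricity_coordMetric_restr_ne_top` and `IsLocalizable.exists_isLocalizationOf`. -/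

/-- The quadratic form `u ↦ uᵀ A u` of a matrix. -/
def matrixForm (A : Matrix (Fin n) (Fin n) ℝ) (u : Euc n) : ℝ := u.ofLp ⬝ᵥ A *ᵥ u.ofLp

/-- By cyclicity the right side is `∑ dᵢ Sᵢᵢ` with `S = U* T U`, which has the trace of `T` and a
non-negative diagonal. `T` need not be diagonalized. -/
theorem le_trace_conj_diagonal_mul {U T : Matrix (Fin n) (Fin n) ℝ} {d : Fin n → ℝ} {c : ℝ}
    (hU : U * star U = 1) (hT : T.PosSemidef) (hd : ∀ i, c ≤ d i) :
    c * T.trace ≤ (U * Matrix.diagonal d * star U * T).trace := by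
  have hS : (star U * T * U).PosSemidef := by
    simpa [Matrix.star_eq_conjTranspose] using hT.conjTranspose_mul_mul_same U
  have h1 : T.trace = ∑ i, (star U * T * U) i i := by
    change _ = (star U * T * U).trace
    rw [Matrix.trace_mul_comm, ← mul_assoc, hU, one_mul]
  have h2 : (U * Matrix.diagonal d * star U * T).trace = ∑ i, d i * (star U * T * U) i i := by
    rw [mul_assoc, mul_assoc, Matrix.trace_mul_comm, mul_assoc, Matrix.trace]
    simp [Matrix.diagonal_mul]
  rw [h1, h2, Finset.mul_sum]
  exact Finset.sum_le_sum fun i _ => mul_le_mul_of_nonneg_right (hd i) hS.diag_nonneg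

theorem Matrix.IsHermitian.eq_conj_diagonal {A : Matrix (Fin n) (Fin n) ℝ} (hA : A.IsHermitian) :
    A = (hA.eigenvectorUnitary : Matrix (Fin n) (Fin n) ℝ) * Matrix.diagonal hA.eigenvalues *
      star (hA.eigenvectorUnitary : Matrix (Fin n) (Fin n) ℝ) := by
  conv_lhs => rw [hA.spectral_theorem, Unitary.conjStarAlgAut_apply]
  rfl

theorem Matrix.IsHermitian.le_trace_mul {A T : Matrix (Fin n) (Fin n) ℝ} (hA : A.IsHermitian)
    (hT : T.PosSemidef) {c : ℝ} (hc : ∀ i, c ≤ hA.eigenvalues i) :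
    c * T.trace ≤ (A * T).trace := by
  conv_rhs => rw [hA.eq_conj_diagonal]
  exact le_trace_conj_diagonal_mul (Unitary.coe_mul_star_self _) hT hc

/-- `A` and `A⁻¹` share an eigenbasis, so upper eigenvalue bounds for `A` become lower trace bounds
for `A⁻¹`. -/
theorem Matrix.PosDef.inv_eq_conj_diagonal {A : Matrix (Fin n) (Fin n) ℝ} (hA : A.PosDef) :
    A⁻¹ = (hA.1.eigenvectorUnitary : Matrix (Fin n) (Fin n) ℝ) *
      Matrix.diagonal (fun i => (hA.1.eigenvalues i)⁻¹) *
      star (hA.1.eigenvectorUnitary : Matrix (Fin n) (Fin n) ℝ) := by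
  apply Matrix.inv_eq_left_inv
  have hU : star (hA.1.eigenvectorUnitary : Matrix (Fin n) (Fin n) ℝ) *
    (hA.1.eigenvectorUnitary : Matrix (Fin n) (Fin n) ℝ) = 1 := Unitary.coe_star_mul_self _
  have hU' : (hA.1.eigenvectorUnitary : Matrix (Fin n) (Fin n) ℝ) *
    star (hA.1.eigenvectorUnitary : Matrix (Fin n) (Fin n) ℝ) = 1 := Unitary.coe_mul_star_self _
  have hdiag : Matrix.diagonal (fun i => (hA.1.eigenvalues i)⁻¹) *
      Matrix.diagonal hA.1.eigenvalues = (1 : Matrix (Fin n) (Fin n) ℝ) := by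
    rw [Matrix.diagonal_mul_diagonal, ← Matrix.diagonal_one]
    congr 1
    ext i
    exact inv_mul_cancel₀ (hA.eigenvalues_pos i).ne'
  refine (congrArg (_ * ·) hA.1.eq_conj_diagonal).trans ?_
  generalize (hA.1.eigenvectorUnitary : Matrix (Fin n) (Fin n) ℝ) = U at *
  calc U * Matrix.diagonal (fun i => (hA.1.eigenvalues i)⁻¹) * star U *
        (U * Matrix.diagonal hA.1.eigenvalues * star U)
      = U * Matrix.diagonal (fun i => (hA.1.eigenvalues i)⁻¹) * (star U * U) *
        Matrix.diagonal hA.1.eigenvalues * star U := by simp only [mul_assoc]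
    _ = U * (Matrix.diagonal (fun i => (hA.1.eigenvalues i)⁻¹) *
        Matrix.diagonal hA.1.eigenvalues) * star U := by simp only [hU, mul_one, mul_assoc]
    _ = 1 := by rw [hdiag, mul_one, hU']

theorem Matrix.PosDef.le_trace_inv_mul {A T : Matrix (Fin n) (Fin n) ℝ} (hA : A.PosDef)
    (hT : T.PosSemidef) {c : ℝ} (hc : ∀ i, hA.1.eigenvalues i ≤ c) :
    c⁻¹ * T.trace ≤ (A⁻¹ * T).trace := by
  rw [hA.inv_eq_conj_diagonal]
  exact le_trace_conj_diagonal_mul (Unitary.coe_mul_star_self _) hT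
    fun i => inv_anti₀ (hA.eigenvalues_pos i) (hc i)

theorem Matrix.IsHermitian.matrixForm_eigenvector {A : Matrix (Fin n) (Fin n) ℝ}
    (hA : A.IsHermitian) (i : Fin n) :
    matrixForm A (hA.eigenvectorBasis i) = hA.eigenvalues i := by
  rw [hA.eigenvalues_eq]
  simp [matrixForm]

/-- Positive constants `l ≤ m` with `m ≤ a l` bounding the eigenvalues of a positive matrix with
eccentricity at most `a`. -/
theorem Matrix.PosDef.exists_eigenvalue_bounds [NeZero n] {A : Matrix (Fin n) (Fin n) ℝ}
    (hA : A.PosDef) {a : ℝ}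
    (ha : ∀ u v : Euc n, ‖u‖ = 1 → ‖v‖ = 1 → matrixForm A u ≤ a * matrixForm A v) :
    ∃ l m : ℝ, 0 < l ∧ 0 < m ∧ m ≤ a * l ∧ (∀ i, l ≤ hA.1.eigenvalues i) ∧
      ∀ i, hA.1.eigenvalues i ≤ m := by
  -- The bounds are the extreme eigenvalues, which are values of the form at unit eigenvectors, so
  -- `ha` compares them.
  obtain ⟨i, hi⟩ := Finite.exists_min hA.1.eigenvalues
  obtain ⟨j, hj⟩ := Finite.exists_max hA.1.eigenvalues
  refine ⟨_, _, hA.eigenvalues_pos i, hA.eigenvalues_pos j, ?_, hi, hj⟩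
  rw [← hA.1.matrixForm_eigenvector, ← hA.1.matrixForm_eigenvector]
  exact ha _ _ (hA.1.eigenvectorBasis.orthonormal.1 j) (hA.1.eigenvectorBasis.orthonormal.1 i)

theorem Matrix.PosDef.pow_le_det {A : Matrix (Fin n) (Fin n) ℝ} (hA : A.PosDef) {l : ℝ}
    (hl : 0 ≤ l) (h : ∀ i, l ≤ hA.1.eigenvalues i) : l ^ n ≤ A.det := by
  rw [hA.1.det_eq_prod_eigenvalues]
  simpa using Finset.prod_le_prod (s := Finset.univ) (fun i _ => hl) fun i _ => h i

theorem Matrix.PosDef.det_le_pow {A : Matrix (Fin n) (Fin n) ℝ} (hA : A.PosDef) {m : ℝ}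
    (h : ∀ i, hA.1.eigenvalues i ≤ m) : A.det ≤ m ^ n := by
  rw [hA.1.det_eq_prod_eigenvalues]
  simpa using Finset.prod_le_prod (s := Finset.univ)
    (fun i _ => (hA.eigenvalues_pos i).le) fun i _ => h i

theorem det_jacobianMatrix (L : Euc n →L[ℝ] Euc n) : (jacobianMatrix L).det = L.det :=
  LinearMap.det_toMatrix _ _

theorem jacobianMatrix_apply (L : Euc n →L[ℝ] Euc n) (i j : Fin n) :
    jacobianMatrix L i j = L (EuclideanSpace.basisFun (Fin n) ℝ j) i := by
  simp [jacobianMatrix, LinearMap.toMatrix_apply]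

/-- The operator norm is at most the Hilbert–Schmidt norm. -/
theorem sq_norm_le_trace (L : Euc n →L[ℝ] Euc n) :
    ‖L‖ ^ 2 ≤ (jacobianMatrix L * (jacobianMatrix L)ᵀ).trace := by
  set S : ℝ := ∑ j, ‖L (EuclideanSpace.basisFun (Fin n) ℝ j)‖ ^ 2 with hS
  have htr : (jacobianMatrix L * (jacobianMatrix L)ᵀ).trace = S := by
    simp only [Matrix.trace, Matrix.diag, Matrix.mul_apply, Matrix.transpose_apply,
      jacobianMatrix_apply, hS, EuclideanSpace.norm_sq_eq, Real.norm_eq_abs, sq_abs]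
    rw [Finset.sum_comm]
    simp only [sq]
  have hS0 : 0 ≤ S := Finset.sum_nonneg fun _ _ => sq_nonneg _
  rw [htr]
  have hb : ‖L‖ ≤ √S := by
    refine L.opNorm_le_bound (Real.sqrt_nonneg _) fun v => ?_
    have hv : L v = ∑ j, v j • L (EuclideanSpace.basisFun (Fin n) ℝ j) := by
      conv_lhs => rw [← (EuclideanSpace.basisFun (Fin n) ℝ).sum_repr v]
      simp
    calc ‖L v‖ ≤ ∑ j, ‖L (EuclideanSpace.basisFun (Fin n) ℝ j)‖ * ‖v j‖ := by
          rw [hv]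
          refine (norm_sum_le _ _).trans_eq (Finset.sum_congr rfl fun j _ => ?_)
          rw [norm_smul, mul_comm]
      _ ≤ √S * √(∑ j, ‖v j‖ ^ 2) := Real.sum_mul_le_sqrt_mul_sqrt _ _ _
      _ = √S * ‖v‖ := by rw [EuclideanSpace.norm_eq]
  calc ‖L‖ ^ 2 ≤ √S ^ 2 := by gcongr
    _ = S := Real.sq_sqrt hS0

/-- The pointwise comparison of Riemannian and classical distortion. -/
theorem norm_pow_le_of_distortion [NeZero n] {G H : Matrix (Fin n) (Fin n) ℝ} (hG : G.PosDef)
    (hH : H.PosDef) {a b K : ℝ} (hK : 0 ≤ K) (ha0 : 0 ≤ a) (hb0 : 0 ≤ b)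
    (ha : ∀ u v : Euc n, ‖u‖ = 1 → ‖v‖ = 1 → matrixForm G u ≤ a * matrixForm G v)
    (hb : ∀ u v : Euc n, ‖u‖ = 1 → ‖v‖ = 1 → matrixForm H u ≤ b * matrixForm H v)
    (L : Euc n →L[ℝ] Euc n)
    (hL : normTrace G ((jacobianMatrix L)ᵀ * H * jacobianMatrix L) ^ n ≤
      K ^ 2 * invDet G ((jacobianMatrix L)ᵀ * H * jacobianMatrix L)) :
    ‖L‖ ^ n ≤ K * (n * a * b) ^ ((n : ℝ) / 2) * |L.det| := by
  set J := jacobianMatrix L with hJ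
  obtain ⟨l, m, hl, hm, hml, hGl, hGm⟩ := hG.exists_eigenvalue_bounds ha
  obtain ⟨l', m', hl', hm', hml', hHl, hHm⟩ := hH.exists_eigenvalue_bounds hb
  have hn : (0 : ℝ) < n := Nat.cast_pos.2 (NeZero.pos n)
  have hT : (Jᵀ * H * J).PosSemidef := by
    simpa using hH.posSemidef.conjTranspose_mul_mul_same J
  have hJJ : (J * Jᵀ).PosSemidef := by
    simpa using Matrix.posSemidef_self_mul_conjTranspose J
  have h1 : m⁻¹ * (l' * ‖L‖ ^ 2) ≤ (G⁻¹ * (Jᵀ * H * J)).trace := by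
    refine le_trans ?_ (hG.le_trace_inv_mul hT hGm)
    have h2 : (Jᵀ * H * J).trace = (H * (J * Jᵀ)).trace := by
      rw [mul_assoc, Matrix.trace_mul_comm, mul_assoc]
    rw [h2]
    have h3 := hH.1.le_trace_mul hJJ hHl
    have h4 := sq_norm_le_trace L
    have : l' * ‖L‖ ^ 2 ≤ (H * (J * Jᵀ)).trace :=
      (mul_le_mul_of_nonneg_left h4 hl'.le).trans h3
    exact mul_le_mul_of_nonneg_left this (inv_nonneg.2 hm.le)
  have h5 : invDet G (Jᵀ * H * J) ≤ (l ^ n)⁻¹ * m' ^ n * L.det ^ 2 := by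
    have : invDet G (Jᵀ * H * J) = G.det⁻¹ * H.det * L.det ^ 2 := by
      simp only [invDet, Matrix.det_mul, Matrix.det_nonsing_inv, Ring.inverse_eq_inv',
        Matrix.det_transpose, hJ, det_jacobianMatrix]
      ring
    rw [this]
    have hGd := hG.pow_le_det hl.le hGl
    have hHd := hH.det_le_pow hHm
    have := hH.det_pos
    gcongr
  have h6 : (m⁻¹ * l' / n * ‖L‖ ^ 2) ^ n ≤ K ^ 2 * ((l ^ n)⁻¹ * m' ^ n * L.det ^ 2) := by
    refine le_trans ?_ (hL.trans (mul_le_mul_of_nonneg_left h5 (sq_nonneg K)))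
    unfold normTrace
    have : m⁻¹ * l' / n * ‖L‖ ^ 2 ≤ 1 / (n : ℝ) * (G⁻¹ * (Jᵀ * H * J)).trace := by
      calc m⁻¹ * l' / n * ‖L‖ ^ 2 = 1 / (n : ℝ) * (m⁻¹ * (l' * ‖L‖ ^ 2)) := by ring
        _ ≤ _ := by gcongr
    gcongr
  -- Everything is kept squared, so that the half-integer power `n/2` appears only in the final
  -- square root.
  have h7 : (‖L‖ ^ n) ^ 2 ≤ (n * a * b) ^ n * (K * L.det) ^ 2 := by
    have hc : 0 < n * m / l' := by positivity
    calc (‖L‖ ^ n) ^ 2 = (n * m / l') ^ n * (m⁻¹ * l' / n * ‖L‖ ^ 2) ^ n := by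
          rw [← mul_pow, ← pow_mul, mul_comm n 2, pow_mul]
          congr 1
          field_simp
      _ ≤ (n * m / l') ^ n * (K ^ 2 * ((l ^ n)⁻¹ * m' ^ n * L.det ^ 2)) := by gcongr
      _ = (n * (m / l) * (m' / l')) ^ n * (K * L.det) ^ 2 := by
          simp only [mul_pow, div_pow]
          field_simp
      _ ≤ (n * a * b) ^ n * (K * L.det) ^ 2 := by
          have := (div_le_iff₀ hl).2 hml
          have := (div_le_iff₀ hl').2 hml'
          gcongr
  refine (sq_le_sq₀ (by positivity) (by positivity)).1 (h7.trans_eq ?_)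
  have h8 : ((n * a * b) ^ ((n : ℝ) / 2)) ^ 2 = (n * a * b) ^ n := by
    rw [← Real.rpow_natCast _ 2, ← Real.rpow_mul (by positivity), ← Real.rpow_natCast _ n]
    norm_num
  rw [mul_pow, mul_pow, mul_pow (K * _), mul_pow K ((n * a * b) ^ _), h8, sq_abs]
  ring

end LinearAlgebra

/-! ### Eccentricity of coordinate representations of metrics -/

section Eccentricity

variable {n : ℕ}

theorem matrixForm_continuous :
    Continuous fun p : Matrix (Fin n) (Fin n) ℝ × Euc n => matrixForm p.1 p.2 := by
  unfold matrixForm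
  fun_prop

/-- The eccentricity of a coordinate representation of a metric: the supremum over the domain of
the ratio of the values of the metric on Euclidean unit vectors (and at least `1`). -/
noncomputable def CoordMetric.eccentricity (G : CoordMetric n) : ℝ≥0∞ :=
  max 1 (⨆ (x : G.domain) (u : Metric.sphere (0 : Euc n) 1) (v : Metric.sphere (0 : Euc n) 1),
    ENNReal.ofReal (matrixForm (G.matrix x) u / matrixForm (G.matrix x) v))

/-- The supremum alone is `0` on an empty domain; the lower bound keeps the distortion constant at
least `1` and excludes products `0 · ⊤`. -/
theorem CoordMetric.one_le_eccentricity (G : CoordMetric n) : 1 ≤ G.eccentricity :=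
  le_max_left _ _

/-- Finiteness matters because `⊤.toReal = 0`; positive definiteness allows the denominator to be
cleared. -/
theorem CoordMetric.matrixForm_le (G : CoordMetric n) (hG : G.eccentricity ≠ ⊤) (x : G.domain)
    (hx : (G.matrix x).PosDef) (u v : Euc n) (hu : ‖u‖ = 1) (hv : ‖v‖ = 1) :
    matrixForm (G.matrix x) u ≤ G.eccentricity.toReal * matrixForm (G.matrix x) v := by
  have hv0 : 0 < matrixForm (G.matrix x) v := by
    have := hx.dotProduct_mulVec_pos (x := v.ofLp) (by
      intro h
      have : v = 0 := by ext i; simp [h]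
      simp [this] at hv)
    simpa [matrixForm] using this
  rw [← div_le_iff₀ hv0]
  refine (ENNReal.ofReal_le_iff_le_toReal hG).1 (le_trans ?_ (le_max_right _ _))
  exact le_iSup_of_le x (le_iSup_of_le ⟨u, by simpa using hu⟩
    (le_iSup_of_le ⟨v, by simpa using hv⟩ le_rfl))

/-- The distortion constant `K (n · ecc g · ecc h)^{n/2}`. -/
noncomputable def distortionConstant (K : ℝ) (G H : CoordMetric n) : ℝ≥0∞ :=
  ENNReal.ofReal K * (n * G.eccentricity * H.eccentricity) ^ ((n : ℝ) / 2)

theorem eccentricity_ne_top_of_distortionConstant_ne_top [NeZero n] {K : ℝ} (hK : 1 ≤ K)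
    {G H : CoordMetric n} (h : distortionConstant K G H ≠ ⊤) :
    G.eccentricity ≠ ⊤ ∧ H.eccentricity ≠ ⊤ := by
  have hn : (n : ℝ≥0∞) ≠ 0 := by simpa using NeZero.ne n
  have hn' : (0 : ℝ) < n := Nat.cast_pos.2 (NeZero.pos n)
  have hG0 : G.eccentricity ≠ 0 := (one_pos.trans_le G.one_le_eccentricity).ne'
  have hH0 : H.eccentricity ≠ 0 := (one_pos.trans_le H.one_le_eccentricity).ne'
  have hK0 : ENNReal.ofReal K ≠ 0 := by simpa using one_pos.trans_le hK
  have h1 : (n * G.eccentricity * H.eccentricity) ≠ ⊤ := by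
    intro h'
    apply h
    rw [distortionConstant, h', ENNReal.top_rpow_of_pos (by positivity), ENNReal.mul_top hK0]
  constructor
  · intro h'
    rw [h', ENNReal.mul_top hn, ENNReal.top_mul hH0] at h1
    exact h1 rfl
  · intro h'
    rw [h', ENNReal.mul_top (mul_ne_zero hn hG0)] at h1
    exact h1 rfl

theorem distortionConstant_ne_top {K : ℝ} {G H : CoordMetric n} (hG : G.eccentricity ≠ ⊤)
    (hH : H.eccentricity ≠ ⊤) : distortionConstant K G H ≠ ⊤ :=
  ENNReal.mul_ne_top ENNReal.ofReal_ne_top (ENNReal.rpow_ne_top_of_nonneg (by positivity)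
    (ENNReal.mul_ne_top (ENNReal.mul_ne_top (ENNReal.natCast_ne_top n) hG) hH))

theorem toReal_distortionConstant {K : ℝ} (hK : 0 ≤ K) (G H : CoordMetric n) :
    (distortionConstant K G H).toReal =
      K * (n * G.eccentricity.toReal * H.eccentricity.toReal) ^ ((n : ℝ) / 2) := by
  simp [distortionConstant, ENNReal.toReal_mul, ENNReal.toReal_ofReal hK, ← ENNReal.toReal_rpow]

theorem one_le_distortionConstant [NeZero n] {K : ℝ} (hK : 1 ≤ K) (G H : CoordMetric n) :
    1 ≤ distortionConstant K G H := by
  have hn : (1 : ℝ≥0∞) ≤ n := by exact_mod_cast NeZero.one_le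
  refine one_le_mul_of_one_le_of_one_le (by simpa using hK) (ENNReal.one_le_rpow ?_ (by
    have := NeZero.pos n
    positivity))
  exact one_le_mul_of_one_le_of_one_le
    (one_le_mul_of_one_le_of_one_le hn G.one_le_eccentricity) H.one_le_eccentricity

end Eccentricity

/-! ### Metrics in charts -/

section Charts

variable {n : ℕ} {M : Type*} [TopologicalSpace M] [ChartedSpace (Euc n) M]

/-- An inverse chart is a diffeomorphism onto its image. This makes coordinate metrics positive
definite. -/
theorem mfderiv_symm_injective {ψ : OpenPartialHomeomorph M (Euc n)}
    (hψ : ψ ∈ IsManifold.maximalAtlas 𝓘(ℝ, Euc n) 1 M) {x : Euc n} (hx : x ∈ ψ.target) :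
    Function.Injective (mfderiv 𝓘(ℝ, Euc n) 𝓘(ℝ, Euc n) ψ.symm x) := by
  have h : ψ.MDifferentiable 𝓘(ℝ, Euc n) 𝓘(ℝ, Euc n) :=
    ⟨fun y hy => (mdifferentiableAt_of_mem_maximalAtlas hψ hy).mdifferentiableWithinAt,
      fun y hy => (mdifferentiableAt_symm_of_mem_maximalAtlas hψ hy).mdifferentiableWithinAt⟩
  exact h.symm.mfderiv_injective hx

/-- Restricting a chart keeps the transition functions and only removes points, so maximality of the
atlas applies. -/
theorem OrientedAtlas.restr_mem_charts (o : OrientedAtlas n M)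
    {ψ : OpenPartialHomeomorph M (Euc n)} (hψ : ψ ∈ o.charts) {V : Set M} (hV : IsOpen V) :
    ψ.restr V ∈ o.charts := by
  refine o.maximal _ (restr_mem_maximalAtlas (contDiffGroupoid 1 𝓘(ℝ, Euc n))
    (o.subset_maximalAtlas hψ) hV) fun ψ' hψ' p hp => ?_
  rw [ψ.restr_source] at hp
  exact o.compatible ψ hψ ψ' hψ' p ⟨hp.1.1, hp.2⟩

variable [IsManifold 𝓘(ℝ, Euc n) 1 M]

theorem matrixForm_metricMatrix (g : ContMetric n M) (ψ : OpenPartialHomeomorph M (Euc n))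
    (x u : Euc n) : matrixForm (metricMatrix g ψ x) u =
      g.inner (ψ.symm x) (mfderiv 𝓘(ℝ, Euc n) 𝓘(ℝ, Euc n) ψ.symm x u)
        (mfderiv 𝓘(ℝ, Euc n) 𝓘(ℝ, Euc n) ψ.symm x u) := by
  set d : Euc n →L[ℝ] TangentSpace 𝓘(ℝ, Euc n) (ψ.symm x) :=
    mfderiv 𝓘(ℝ, Euc n) 𝓘(ℝ, Euc n) ψ.symm x
  have hu : d u = ∑ i, u i • d (EuclideanSpace.basisFun (Fin n) ℝ i) := by
    conv_lhs => rw [← (EuclideanSpace.basisFun (Fin n) ℝ).sum_repr u]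
    rw [map_sum]
    simp
  change _ = g.inner (ψ.symm x) (d u) (d u)
  rw [hu]
  simp only [map_sum, map_smul, _root_.sum_apply, _root_.smul_apply,
    smul_eq_mul, Finset.mul_sum, matrixForm, dotProduct, Matrix.mulVec, metricMatrix,
    Matrix.of_apply]
  rw [Finset.sum_comm]
  refine Finset.sum_congr rfl fun i _ => Finset.sum_congr rfl fun j _ => ?_
  have hcomm : ∀ a b c : ℝ, a * (b * c) = c * (a * b) := fun a b c => by ring
  exact hcomm _ _ _

theorem matrixForm_metricMatrix_pos (g : ContMetric n M) {ψ : OpenPartialHomeomorph M (Euc n)}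
    (hψ : ψ ∈ IsManifold.maximalAtlas 𝓘(ℝ, Euc n) 1 M) {x : Euc n} (hx : x ∈ ψ.target)
    {u : Euc n} (hu : u ≠ 0) : 0 < matrixForm (metricMatrix g ψ x) u := by
  rw [matrixForm_metricMatrix]
  refine g.pos _ _ fun h => hu ?_
  exact mfderiv_symm_injective hψ hx (h.trans (map_zero _).symm)

theorem posDef_metricMatrix (g : ContMetric n M) {ψ : OpenPartialHomeomorph M (Euc n)}
    (hψ : ψ ∈ IsManifold.maximalAtlas 𝓘(ℝ, Euc n) 1 M) {x : Euc n} (hx : x ∈ ψ.target) :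
    (metricMatrix g ψ x).PosDef := by
  refine Matrix.PosDef.of_dotProduct_mulVec_pos ?_ fun {v} hv => ?_
  · ext i j
    simpa [metricMatrix] using g.symm _ _ _
  · have := matrixForm_metricMatrix_pos g hψ hx (u := WithLp.toLp 2 v) (by simpa using hv)
    simpa [matrixForm] using this

/-- As `ψ.symm` is `C¹`, the coordinate vector fields are continuous along it, and each entry pairs
two of them by the continuous metric. -/
theorem continuousOn_metricMatrix (g : ContMetric n M) {ψ : OpenPartialHomeomorph M (Euc n)}
    (hψ : ψ ∈ IsManifold.maximalAtlas 𝓘(ℝ, Euc n) 1 M) :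
    ContinuousOn (metricMatrix g ψ) ψ.target := by
  have hsymm : ContMDiffOn 𝓘(ℝ, Euc n) 𝓘(ℝ, Euc n) 1 ψ.symm ψ.target :=
    contMDiffOn_symm_of_mem_maximalAtlas hψ
  have htan := hsymm.continuousOn_tangentMapWithin le_rfl ψ.open_target.uniqueMDiffOn
  have hvec : ∀ u : Euc n, ContinuousOn (fun x => Bundle.TotalSpace.mk' (Euc n)
      (E := fun p : M => TangentSpace 𝓘(ℝ, Euc n) p) (ψ.symm x)
      (mfderiv 𝓘(ℝ, Euc n) 𝓘(ℝ, Euc n) ψ.symm x u)) ψ.target := by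
    intro u
    have hsec : Continuous (fun x : Euc n => (⟨x, u⟩ : TangentBundle 𝓘(ℝ, Euc n) (Euc n))) :=
      (tangentBundleModelSpaceHomeomorph 𝓘(ℝ, Euc n)).symm.continuous.comp
        (continuous_id.prodMk continuous_const)
    refine (htan.comp hsec.continuousOn fun x hx => hx).congr fun x hx => ?_
    simp only [Function.comp, tangentMapWithin]
    rw [mfderivWithin_of_isOpen ψ.open_target hx]
  refine continuousOn_pi.2 fun i => continuousOn_pi.2 fun j => ?_
  have hg : ContinuousOn (fun x => Bundle.TotalSpace.mk' (Euc n →L[ℝ] Euc n →L[ℝ] ℝ)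
      (E := fun p : M => TangentSpace 𝓘(ℝ, Euc n) p →L[ℝ] TangentSpace 𝓘(ℝ, Euc n) p →L[ℝ] ℝ)
      (ψ.symm x) (g.inner (ψ.symm x))) ψ.target :=
    g.continuous.comp_continuousOn ψ.continuousOn_symm
  have h := ContinuousOn.clm_bundle_apply₂ (F₃ := ℝ) (E₃ := Bundle.Trivial M ℝ) hg
    (hvec (EuclideanSpace.basisFun (Fin n) ℝ i)) (hvec (EuclideanSpace.basisFun (Fin n) ℝ j))
  intro x hx
  have := h x hx
  rw [FiberBundle.continuousWithinAt_totalSpace] at this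
  exact this.2

/-- If the coordinate domain lies in a compact subset of a larger chart, the eccentricity is
finite. -/
theorem eccentricity_coordMetric_restr_ne_top (g : ContMetric n M)
    {ψ : OpenPartialHomeomorph M (Euc n)}
    (hψ : ψ ∈ IsManifold.maximalAtlas 𝓘(ℝ, Euc n) 1 M) {V : Set M} (hV : IsOpen V)
    (hc : IsCompact (closure V)) (hVψ : closure V ⊆ ψ.source) :
    (coordMetric g (ψ.restr V)).eccentricity ≠ ⊤ := by
  have hk : IsCompact (ψ '' closure V) := hc.image_of_continuousOn (ψ.continuousOn.mono hVψ)
  have hkt : ψ '' closure V ⊆ ψ.target := (image_mono hVψ).trans ψ.mapsTo.image_subset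
  have hne : ∀ v ∈ Metric.sphere (0 : Euc n) 1, v ≠ 0 := by
    rintro v hv rfl
    simp at hv
  -- The ratio is continuous on a compact product with two unit spheres, hence bounded. The
  -- restricted chart has the same inverse function, so its matrices are those of `ψ`.
  have hcont : ContinuousOn (fun p : Euc n × Euc n × Euc n =>
      matrixForm (metricMatrix g ψ p.1) p.2.1 / matrixForm (metricMatrix g ψ p.1) p.2.2)
      ((ψ '' closure V) ×ˢ Metric.sphere (0 : Euc n) 1 ×ˢ Metric.sphere (0 : Euc n) 1) := by
    have hm : ContinuousOn (fun p : Euc n × Euc n × Euc n => metricMatrix g ψ p.1)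
        ((ψ '' closure V) ×ˢ Metric.sphere (0 : Euc n) 1 ×ˢ Metric.sphere (0 : Euc n) 1) :=
      (continuousOn_metricMatrix g hψ).comp continuousOn_fst fun p hp => hkt hp.1
    refine ContinuousOn.div
      (matrixForm_continuous.comp_continuousOn (hm.prodMk (by fun_prop)))
      (matrixForm_continuous.comp_continuousOn (hm.prodMk (by fun_prop))) fun p hp => ?_
    exact (matrixForm_metricMatrix_pos g hψ (hkt hp.1) (hne _ hp.2.2)).ne'
  obtain ⟨c, hcb⟩ := ((hk.prod ((isCompact_sphere 0 1).prod
    (isCompact_sphere 0 1))).image_of_continuousOn hcont).bddAbove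
  refine ne_top_of_le_ne_top (max_ne_top ENNReal.one_ne_top (ENNReal.ofReal_ne_top (r := c)))
    (max_le_max le_rfl (iSup_le fun x => iSup_le fun u => iSup_le fun v =>
      ENNReal.ofReal_le_ofReal (hcb ⟨(x.1, u.1, v.1), ⟨?_, u.2, v.2⟩, rfl⟩)))
  have hx : x.1 ∈ (ψ.restr V).target := x.2
  rw [ψ.restr_target, hV.interior_eq] at hx
  exact ⟨ψ.symm x.1, subset_closure hx.2, ψ.right_inv hx.1⟩

end Charts

/-! ### Quasiregularity of localizations and existence of good ones -/

section Quasiregular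

variable {n : ℕ} {M N : Type*} [TopologicalSpace M] [ChartedSpace (Euc n) M]
  [TopologicalSpace N] [ChartedSpace (Euc n) N]
  {oM : OrientedAtlas n M} {oN : OrientedAtlas n N} {φ : M → N}

theorem IsLocalizationOf.coordRep_mem {ψ : OpenPartialHomeomorph M (Euc n)}
    {χ : OpenPartialHomeomorph N (Euc n)} (hloc : IsLocalizationOf oM oN φ ψ χ) {x : Euc n}
    (hx : x ∈ ψ.target) : coordRep φ ψ χ x ∈ χ.target :=
  χ.map_source (hloc.compactlyContained.2
    (subset_closure (mem_image_of_mem φ (ψ.map_target hx))))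

variable [IsManifold 𝓘(ℝ, Euc n) 1 M] [IsManifold 𝓘(ℝ, Euc n) 1 N]
  {g : ContMetric n M} {h : ContMetric n N} {K : ℝ}

/-- Localizations with finite distortion constant are quasiregular in the classical sense. -/
theorem IsRiemannianQuasiregular.isClassicallyQuasiregular [NeZero n]
    (hφ : IsRiemannianQuasiregular oM oN g h K φ) {ψ : OpenPartialHomeomorph M (Euc n)}
    {χ : OpenPartialHomeomorph N (Euc n)} (hloc : IsLocalizationOf oM oN φ ψ χ)
    (hC : distortionConstant K (coordMetric g ψ) (coordMetric h χ) ≠ ⊤) :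
    IsClassicallyQuasiregular
      (distortionConstant K (coordMetric g ψ) (coordMetric h χ)).toReal
      ψ.target (coordRep φ ψ χ) where
  isOpen := ψ.open_target
  one_le := by
    simpa using (ENNReal.toReal_le_toReal ENNReal.one_ne_top hC).2
      (one_le_distortionConstant hφ.one_le _ _)
  sobolev := hφ.sobolev ψ χ hloc
  sign := hφ.sign ψ χ hloc
  distortion := by
    intro D hD
    have hK : 0 ≤ K := zero_le_one.trans hφ.one_le
    obtain ⟨hg, hh⟩ := eccentricity_ne_top_of_distortionConstant_ne_top hφ.one_le hC
    filter_upwards [hφ.distortion ψ χ hloc D hD,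
      ae_restrict_mem ψ.open_target.measurableSet] with x hx hxt
    have hG := posDef_metricMatrix g (oM.subset_maximalAtlas hloc.mem_left) hxt
    have hH := posDef_metricMatrix h (oN.subset_maximalAtlas hloc.mem_right)
      (hloc.coordRep_mem hxt)
    rw [toReal_distortionConstant hK]
    exact norm_pow_le_of_distortion hG hH hK ENNReal.toReal_nonneg ENNReal.toReal_nonneg
      ((coordMetric g ψ).matrixForm_le hg ⟨x, hxt⟩ hG)
      ((coordMetric h χ).matrixForm_le hh ⟨_, hloc.coordRep_mem hxt⟩ hH) (D x) hx

/-- A localizable map has localizations at every point in which both metrics have finite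
eccentricity. -/
theorem IsLocalizable.exists_isLocalizationOf [T2Space M] [T2Space N] (oM : OrientedAtlas n M)
    (g : ContMetric n M) (h : ContMetric n N) (hφ : IsLocalizable oN φ) (p : M) :
    ∃ ψ χ, p ∈ ψ.source ∧ IsLocalizationOf oM oN φ ψ χ ∧
      (coordMetric g ψ).eccentricity ≠ ⊤ ∧ (coordMetric h χ).eccentricity ≠ ⊤ := by
  have : LocallyCompactSpace M := ChartedSpace.locallyCompactSpace (Euc n) M
  have : LocallyCompactSpace N := ChartedSpace.locallyCompactSpace (Euc n) N
  obtain ⟨U, hU, χ, hχ, hUc, hUχ⟩ := hφ p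
  obtain ⟨ψ, hψ, hpψ⟩ := oM.cover p
  -- Both charts are shrunk: `V` lies between the closure of `φ '' U` and `χ.source`, and `W` around
  -- `p` has closure inside `ψ.source` and the interior of `U`, so that `φ '' W` stays in `φ '' U`.
  obtain ⟨V, hV, hUV, hVχ, hVc⟩ :=
    exists_open_between_and_isCompact_closure hUc χ.open_source hUχ
  obtain ⟨W, hW, hpW, hWψ, hWc⟩ := exists_open_between_and_isCompact_closure
    (isCompact_singleton (x := p)) (ψ.open_source.inter isOpen_interior)
    (singleton_subset_iff.2 ⟨hpψ, mem_interior_iff_mem_nhds.2 hU⟩)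
  have hWU : φ '' (ψ.restr W).source ⊆ φ '' U := by
    rw [ψ.restr_source, hW.interior_eq]
    exact image_mono fun x hx => interior_subset (hWψ (subset_closure hx.2)).2
  refine ⟨ψ.restr W, χ.restr V, ?_, ⟨oM.restr_mem_charts hψ hW, oN.restr_mem_charts hχ hV,
    hUc.of_isClosed_subset isClosed_closure (closure_mono hWU), ?_⟩, ?_, ?_⟩
  · rw [ψ.restr_source, hW.interior_eq]
    exact ⟨hpψ, singleton_subset_iff.1 hpW⟩
  · rw [χ.restr_source, hV.interior_eq]
    exact (closure_mono hWU).trans (subset_inter hUχ hUV)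
  · exact eccentricity_coordMetric_restr_ne_top g (oM.subset_maximalAtlas hψ) hW hWc
      (hWψ.trans inter_subset_left)
  · exact eccentricity_coordMetric_restr_ne_top h (oN.subset_maximalAtlas hχ) hV hVc hVχ

end Quasiregular

theorem mainTheorem4 (n : ℕ) (hn : 2 ≤ n) :
    ∃ C : ℝ → CoordMetric n → CoordMetric n → ℝ≥0∞,
      ∀ (M : Type*) [TopologicalSpace M] [T2Space M] [SecondCountableTopology M]
        [ChartedSpace (Euc n) M] [IsManifold 𝓘(ℝ, Euc n) 1 M]
        (N : Type*) [TopologicalSpace N] [T2Space N] [SecondCountableTopology N]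
        [ChartedSpace (Euc n) N] [IsManifold 𝓘(ℝ, Euc n) 1 N]
        (oM : OrientedAtlas n M) (oN : OrientedAtlas n N)
        (g : ContMetric n M) (h : ContMetric n N) (K : ℝ) (φ : M → N),
        IsRiemannianQuasiregular oM oN g h K φ →
          (∀ p : M, ∃ ψ χ, p ∈ ψ.source ∧ IsLocalizationOf oM oN φ ψ χ ∧
            C K (coordMetric g ψ) (coordMetric h χ) ≠ ⊤ ∧
            IsClassicallyQuasiregular (C K (coordMetric g ψ) (coordMetric h χ)).toReal
              ψ.target (coordRep φ ψ χ)) ∧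
          (∀ ψ χ, IsLocalizationOf oM oN φ ψ χ →
            C K (coordMetric g ψ) (coordMetric h χ) ≠ ⊤ →
            IsClassicallyQuasiregular (C K (coordMetric g ψ) (coordMetric h χ)).toReal
              ψ.target (coordRep φ ψ χ)) := by
  have : NeZero n := ⟨by omega⟩
  refine ⟨distortionConstant, ?_⟩
  intro M _ _ _ _ _ N _ _ _ _ _ oM oN g h K φ hφ
  refine ⟨fun p => ?_, fun ψ χ hloc hC => hφ.isClassicallyQuasiregular hloc hC⟩
  obtain ⟨ψ, χ, hp, hloc, hg, hh⟩ := hφ.localizable.exists_isLocalizationOf oM g h p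
  exact ⟨ψ, χ, hp, hloc, distortionConstant_ne_top hg hh,
    hφ.isClassicallyQuasiregular hloc (distortionConstant_ne_top hg hh)⟩
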